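/- Let $\mathbb{F}\in\{\mathbb{R},\mathbb{C}\}$, let $g\ge 0$ be an integer, and let $\mathcal{A}=\mathbb{F}\langle x,x^*\rangle$ be the free $*$-algebra in $x=(x_1,\dots,x_g)$: the free unital associative $\mathbb{F}$-algebra on the $2g$ noncommuting letters $x_1,\dots,x_g,x_1^*,\dots,x_g^*$, with the conjugate-linear involution that reverses words and exchanges $x_j$ and $x_j^*$. A polynomial is *analytic* if it is a polynomial in $x_1,\dots,x_g$ only. A left ideal $I\subseteq\mathcal{A}$ is a *$*$-ideal* if $I^*=I$ (such an ideal is automatically two-sided), and it is *real* if, for all $a_1,\dots,a_n\in\mathcal{A}$, $\sum_j a_j^*a_j\in I+I^*$ implies $a_j\in I$ for every $j$. The *real radical* $\sqrt[\mathrm{real}]{I}$ is the intersection of all real left ideals containing $I$. A *$*$-representation* of $\mathcal{A}$ is a unital $*$-homomorphism $\pi$ from $\mathcal{A}$ to the $*$-algebra of all adjointable linear operators on some (not necessarily complete) pre-Hilbert space over $\mathbb{F}$. Let $\mathcal{R}$ be the class of all $*$-representations of $\mathcal{A}$, and let $$\sqrt[\mathcal{R}\text{-hard}]{I}=\{a\in\mathcal{A}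 : \pi(a)=0 \text{ for every } \pi\in\mathcal{R} \text{ with } \pi(s)=0 \text{ for all } s\in I\}.$$ If $I\subseteq\mathbb{F}\langle x,x^*\rangle$ is the $*$-ideal generated by some (finite or infinite) set of analytic polynomials, that is, the smallest $*$-ideal containing this set, then $$\sqrt[\mathrm{real}]{I}=\sqrt[\mathcal{R}\text{-hard}]{I}=I.$$ In particular, $I$ is real. -/

import Mathlib

universe w

noncomputable section

/-! ### Left ideals, real ideals and radicals in a general `*`-algebra

Throughout, `A` is a unital associative `*`-algebra over `𝕜 ∈ {ℝ, ℂ}`. Mathlib's `Ideal A` is the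
type of left ideals of the (noncommutative) ring `A`. -/

section General

variable {A : Type*} [Ring A] [StarRing A]

/-- A left ideal `I` is a `*`-ideal if `I = I^*`. (Such a left ideal is two-sided, see
`IsStarIdeal.mul_mem_right`.) -/
def IsStarIdeal (I : Ideal A) : Prop :=
  ∀ a : A, star a ∈ I ↔ a ∈ I

theorem IsStarIdeal.mul_mem_right {I : Ideal A} (hI : IsStarIdeal I) {a : A} (b : A)
    (ha : a ∈ I) : a * b ∈ I := by
  rw [← hI, star_mul]
  exact I.mul_mem_left _ ((hI a).2 ha)

/-- A left ideal `I` is real if `∑ a_j^* a_j ∈ I + I^*` implies `a_j ∈ I` for each `j`. -/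
def IsRealIdeal (I : Ideal A) : Prop :=
  ∀ (n : ℕ) (a : Fin n → A),
    (∃ b ∈ I, ∃ c ∈ I, ∑ j, star (a j) * a j = b + star c) → ∀ j, a j ∈ I

/-- The real radical of a left ideal `I`: the intersection of all real left ideals containing
`I`. -/
def realRadical (I : Ideal A) : Ideal A :=
  sInf {J : Ideal A | IsRealIdeal J ∧ I ≤ J}

/-- The `*`-ideal generated by a set `S`: the intersection of all `*`-ideals containing `S`. -/
def starIdealSpan (S : Set A) : Ideal A :=
  sInf {J : Ideal A | IsStarIdeal J ∧ S ⊆ (J : Set A)}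

theorem isStarIdeal_starIdealSpan (S : Set A) : IsStarIdeal (starIdealSpan S) := by
  intro a
  simp only [starIdealSpan, Submodule.mem_sInf]
  exact forall₂_congr fun J hJ => hJ.1 a

end General

/-- A `*`-representation of the `*`-algebra `A`: a unital `*`-homomorphism from `A` to the
`*`-algebra of all adjointable operators on some pre-Hilbert space `V` over `𝕜`. The space `V` is
not assumed to be complete and the operators are not assumed to be bounded. The field
`inner_map` says that `toAlgHom a` is adjointable with (unique) adjoint `toAlgHom (star a)`. -/
structure StarRep (𝕜 : Type*) [RCLike 𝕜] (A : Type*) [Ring A] [StarRing A] [Algebra 𝕜 A] where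
  /-- the underlying pre-Hilbert space -/
  V : Type w
  [normedAddCommGroup : NormedAddCommGroup V]
  [innerProductSpace : InnerProductSpace 𝕜 V]
  /-- the action of `A` by linear operators -/
  toAlgHom : A →ₐ[𝕜] Module.End 𝕜 V
  inner_map : ∀ (a : A) (v v' : V),
    inner 𝕜 (toAlgHom a v) v' = inner 𝕜 v (toAlgHom (star a) v')

attribute [instance] StarRep.normedAddCommGroup StarRep.innerProductSpace

section Hard

variable {𝕜 : Type*} [RCLike 𝕜] {A : Type*} [Ring A] [StarRing A] [Algebra 𝕜 A]

/-- The hard vanishing set of a class `T` of `*`-representations: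
all `a` with `π(a) = 0` for every `π ∈ T`. -/
def hardVanishing (T : Set (StarRep.{w} 𝕜 A)) : Ideal A where
  carrier := {a | ∀ π ∈ T, π.toAlgHom a = 0}
  add_mem' {a b} ha hb π hπ := by rw [map_add, ha π hπ, hb π hπ, add_zero]
  zero_mem' π _ := map_zero _
  smul_mem' c a ha π hπ := by rw [smul_eq_mul, map_mul, ha π hπ, mul_zero]

/-- The hard variety of `S ⊆ A` in a class `C` of `*`-representations:
all `π ∈ C` with `π(s) = 0` for every `s ∈ S`. -/
def hardVariety (C : Set (StarRep.{w} 𝕜 A)) (S : Set A) : Set (StarRep.{w} 𝕜 A) :=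
  {π ∈ C | ∀ s ∈ S, π.toAlgHom s = 0}

/-- The hard radical of `S ⊆ A` over a class `C` of `*`-representations. -/
def hardRadical (C : Set (StarRep.{w} 𝕜 A)) (S : Set A) : Ideal A :=
  hardVanishing (hardVariety C S)

end Hard

/-! ### The free `*`-algebra `𝕜⟨x, x^*⟩` -/

/-- Words in the `2g` letters `x_1, …, x_g, x_1^*, …, x_g^*`;
`Sum.inl j` stands for `x_j` and `Sum.inr j` for `x_j^*`. -/
abbrev StarWord (g : ℕ) : Type := FreeMonoid (Fin g ⊕ Fin g)

/-- The involution on words: reverse the word and exchange `x_j` and `x_j^*`. -/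
def StarWord.adjoint {g : ℕ} (u : StarWord g) : StarWord g :=
  FreeMonoid.reverse (FreeMonoid.map Sum.swap u)

theorem StarWord.adjoint_mul {g : ℕ} (u v : StarWord g) :
    (u * v).adjoint = v.adjoint * u.adjoint := by
  simp [StarWord.adjoint, FreeMonoid.reverse_mul]

theorem StarWord.adjoint_adjoint {g : ℕ} (u : StarWord g) : u.adjoint.adjoint = u := by
  induction u using FreeMonoid.recOn with
  | one => rfl
  | of_mul x u ih =>
    rw [adjoint_mul, adjoint_mul, ih]
    simp [StarWord.adjoint]

/-- The free `*`-algebra `𝕜⟨x, x^*⟩` in `g` variables: the `𝕜`-algebra with basis the words in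
`x, x^*`, multiplied by concatenation. -/
abbrev FreeStarAlgebra (𝕜 : Type*) [RCLike 𝕜] (g : ℕ) : Type _ :=
  MonoidAlgebra 𝕜 (StarWord g)

namespace FreeStarAlgebra

variable {𝕜 : Type*} [RCLike 𝕜] {g : ℕ}

/-- The conjugate-linear involution `(∑ c_u u)^* = ∑ conj(c_u) u^*`. -/
instance instStar : Star (FreeStarAlgebra 𝕜 g) where
  star p := (MonoidAlgebra.map (starRingEnd 𝕜).toAddMonoidHom p).mapDomain StarWord.adjoint

theorem star_single (u : StarWord g) (c : 𝕜) :
    star (MonoidAlgebra.single u c : FreeStarAlgebra 𝕜 g) =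
      MonoidAlgebra.single u.adjoint (starRingEnd 𝕜 c) := by
  simp [star, MonoidAlgebra.map_single, MonoidAlgebra.mapDomain_single]

theorem star_add' (p q : FreeStarAlgebra 𝕜 g) : star (p + q) = star p + star q := by
  simp only [star, MonoidAlgebra.map_add, MonoidAlgebra.mapDomain_add]

theorem star_zero' : star (0 : FreeStarAlgebra 𝕜 g) = 0 := by
  simp only [star, MonoidAlgebra.map_zero, MonoidAlgebra.mapDomain_zero]

instance instStarRing : StarRing (FreeStarAlgebra 𝕜 g) where
  star_involutive p := by
    induction p using MonoidAlgebra.induction_linear with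
    | zero => rw [star_zero', star_zero']
    | add p q hp hq => rw [star_add', star_add', hp, hq]
    | single u c => rw [star_single, star_single, StarWord.adjoint_adjoint, RCLike.conj_conj]
  star_mul p q := by
    induction p using MonoidAlgebra.induction_linear with
    | zero => rw [zero_mul, star_zero', mul_zero]
    | add p p' hp hp' => rw [add_mul, star_add', hp, hp', star_add', mul_add]
    | single u c =>
      induction q using MonoidAlgebra.induction_linear with
      | zero => rw [mul_zero, star_zero', zero_mul]
      | add q q' hq hq' => rw [mul_add, star_add', hq, hq', star_add', add_mul]
      | single v d =>
        rw [MonoidAlgebra.single_mul_single, star_single, star_single, star_single,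
          MonoidAlgebra.single_mul_single, StarWord.adjoint_mul, map_mul, mul_comm]
  star_add := star_add'

instance instStarModule : StarModule 𝕜 (FreeStarAlgebra 𝕜 g) where
  star_smul c p := by
    induction p using MonoidAlgebra.induction_linear with
    | zero => rw [smul_zero, star_zero', smul_zero]
    | add p q hp hq => rw [smul_add, star_add', hp, hq, star_add', smul_add]
    | single u d =>
      rw [MonoidAlgebra.smul_single, star_single, star_single, MonoidAlgebra.smul_single,
        smul_eq_mul, map_mul, smul_eq_mul, starRingEnd_apply]

/-- The variable `x_j`. -/
def x (𝕜 : Type*) [RCLike 𝕜] {g : ℕ} (j : Fin g) : FreeStarAlgebra 𝕜 g :=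
  MonoidAlgebra.single (FreeMonoid.of (Sum.inl j)) 1

/-- The algebra `𝕜⟨x⟩ ⊆ 𝕜⟨x, x^*⟩` of analytic polynomials: the polynomials in the variables
`x_1, …, x_g` only. -/
def analytic (𝕜 : Type*) [RCLike 𝕜] (g : ℕ) : Subalgebra 𝕜 (FreeStarAlgebra 𝕜 g) :=
  Algebra.adjoin 𝕜 (Set.range (x 𝕜))

end FreeStarAlgebra

end

/-! It suffices to find one `*`-representation with kernel exactly `I`, when `1 ∉ I`. Then the hard
radical is `I`, and `I` is real because in a pre-Hilbert space `∑ ‖π(a_j) v‖² = 0` forces every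
`π(a_j) v = 0`. By GNS such a representation comes from a functional `L` that vanishes on `I` and
has `re L(a^* a) > 0` for every `a ∉ I`.

The analytic generators enter only through a derivation `δ : A → A ⊗ A` for the outer bimodule
structure, with `δ x_j = 0` and `δ x_j^* = x_j^* ⊗ 1 - 1 ⊗ x_j^*`. It kills analytic `p` and sends
`p^*` to `p^* ⊗ 1 - 1 ⊗ p^*`, so `δ I ⊆ I ⊗ A + A ⊗ I` (`delta_mem_tensorKer`). Hence contractions
of `δ` with maps that factor through `A/I` respect `I`.

One contraction gives an operator `T` with `T I ⊆ I` that, modulo lower degree, is the projection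
onto words starting with some `x_j^*`; put `U = 1 - T`. Take a positive semidefinite form `h` with
kernel `I` plus the polynomials of degree `< d`. Contracting `δ` with `h(U a^*, U b) - h(T a^*, T
b)` gives a functional `M` that vanishes on `I` and below degree `2d`, with `M(a^* b) = h(Ua, Ub) +
h(Ta, Tb)` for `a`, `b` of degree at most `d` (`exists_functional_of_degree`).

So positivity extends from degree `< d` to degree `d`: by Finsler's lemma, add a large multiple of
`M`. This changes nothing below degree `2d`, so the successive functionals stabilize on each word
and their limit is `L`. -/

open scoped TensorProduct

namespace FreeStarAlgebra

variable {𝕜 : Type*} [RCLike 𝕜] {g : ℕ}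

/-! ### Monomials and induction on letters. -/

/-- The monomial of a word. -/
noncomputable def monomial (𝕜 : Type*) [RCLike 𝕜] {g : ℕ} (u : StarWord g) : FreeStarAlgebra 𝕜 g :=
  MonoidAlgebra.single u 1

theorem monomial_one : monomial 𝕜 (1 : StarWord g) = 1 := rfl

theorem monomial_mul (u v : StarWord g) :
    monomial 𝕜 (u * v) = monomial 𝕜 u * monomial 𝕜 v := by
  simp [monomial, MonoidAlgebra.single_mul_single]

theorem star_monomial (u : StarWord g) : star (monomial 𝕜 u) = monomial 𝕜 u.adjoint := by
  simp [monomial, star_single]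

theorem span_range_monomial :
    Submodule.span 𝕜 (Set.range (monomial 𝕜 : StarWord g → FreeStarAlgebra 𝕜 g)) = ⊤ := by
  rw [eq_top_iff]
  rintro a -
  induction a using MonoidAlgebra.induction_linear with
  | zero => exact zero_mem _
  | add p q hp hq => exact add_mem hp hq
  | single u c =>
    have : (MonoidAlgebra.single u c : FreeStarAlgebra 𝕜 g) = c • monomial 𝕜 u := by
      simp [monomial, MonoidAlgebra.smul_single]
    rw [this]
    exact Submodule.smul_mem _ _ (Submodule.subset_span ⟨u, rfl⟩)

theorem induction_letters {p : FreeStarAlgebra 𝕜 g → Prop} (a : FreeStarAlgebra 𝕜 g)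
    (hc : ∀ c : 𝕜, p (algebraMap 𝕜 _ c))
    (hl : ∀ e : Fin g ⊕ Fin g, p (monomial 𝕜 (FreeMonoid.of e)))
    (hadd : ∀ a b, p a → p b → p (a + b)) (hmul : ∀ a b, p a → p b → p (a * b)) : p a := by
  have hw : ∀ u : StarWord g, p (monomial 𝕜 u) := by
    intro u
    induction u using FreeMonoid.recOn with
    | one => rw [monomial_one, ← map_one (algebraMap 𝕜 _)]; exact hc 1
    | of_mul e u ih => rw [monomial_mul]; exact hmul _ _ (hl e) ih
  have ha : a ∈ Submodule.span 𝕜 (Set.range (monomial 𝕜 : StarWord g → _)) := by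
    rw [span_range_monomial]; trivial
  induction ha using Submodule.span_induction with
  | mem x hx => obtain ⟨u, rfl⟩ := hx; exact hw u
  | zero => simpa using hc 0
  | add x y _ _ hx hy => exact hadd _ _ hx hy
  | smul c x _ hx => rw [Algebra.smul_def]; exact hmul _ _ (hc c) hx

/-! ### The derivation killing the analytic letters -/

/-- The triangular matrices of the letters, whose corner is the value of the derivation. -/
noncomputable def letterMatrix (𝕜 : Type*) [RCLike 𝕜] {g : ℕ} (e : Fin g ⊕ Fin g) :
    Matrix (Fin 2) (Fin 2) (FreeStarAlgebra 𝕜 g ⊗[𝕜] FreeStarAlgebra 𝕜 g) :=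
  !![monomial 𝕜 (FreeMonoid.of e) ⊗ₜ 1,
    Sum.elim (fun _ => 0) (fun _ => monomial 𝕜 (FreeMonoid.of e) ⊗ₜ 1
      - 1 ⊗ₜ monomial 𝕜 (FreeMonoid.of e)) e;
    0, 1 ⊗ₜ monomial 𝕜 (FreeMonoid.of e)]

/-- The triangular representation whose corner is the derivation `delta`. -/
noncomputable def deltaHom (𝕜 : Type*) [RCLike 𝕜] (g : ℕ) : FreeStarAlgebra 𝕜 g →ₐ[𝕜]
    Matrix (Fin 2) (Fin 2) (FreeStarAlgebra 𝕜 g ⊗[𝕜] FreeStarAlgebra 𝕜 g) :=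
  MonoidAlgebra.lift 𝕜 _ _ (FreeMonoid.lift (letterMatrix 𝕜))

theorem deltaHom_letter (e : Fin g ⊕ Fin g) :
    deltaHom 𝕜 g (monomial 𝕜 (FreeMonoid.of e)) = letterMatrix 𝕜 e := by
  simp [deltaHom, monomial]

theorem deltaHom_diag (a : FreeStarAlgebra 𝕜 g) :
    deltaHom 𝕜 g a 0 0 = a ⊗ₜ 1 ∧ deltaHom 𝕜 g a 1 0 = 0 ∧ deltaHom 𝕜 g a 1 1 = 1 ⊗ₜ a := by
  induction a using induction_letters with
  | hc c =>
    rw [AlgHom.commutes]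
    simp [Matrix.algebraMap_matrix_apply, Algebra.algebraMap_eq_smul_one,
      TensorProduct.smul_tmul', Algebra.TensorProduct.one_def]
  | hl e => simp [deltaHom_letter, letterMatrix]
  | hadd a b ha hb =>
    simp [ha.1, ha.2.1, ha.2.2, hb.1, hb.2.1, hb.2.2, TensorProduct.add_tmul,
      TensorProduct.tmul_add]
  | hmul a b ha hb =>
    simp [Matrix.mul_apply, Fin.sum_univ_two, ha.1, ha.2.1, ha.2.2, hb.1, hb.2.1, hb.2.2]

/-- The derivation with `δ x_j = 0` and `δ x_j^* = x_j^* ⊗ 1 - 1 ⊗ x_j^*`. -/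
noncomputable def delta (𝕜 : Type*) [RCLike 𝕜] (g : ℕ) :
    FreeStarAlgebra 𝕜 g →ₗ[𝕜] FreeStarAlgebra 𝕜 g ⊗[𝕜] FreeStarAlgebra 𝕜 g where
  toFun a := deltaHom 𝕜 g a 0 1
  map_add' a b := by simp
  map_smul' c a := by simp

theorem delta_mul (a b : FreeStarAlgebra 𝕜 g) :
    delta 𝕜 g (a * b) = delta 𝕜 g a * (1 ⊗ₜ b) + (a ⊗ₜ 1) * delta 𝕜 g b := by
  simp only [delta, LinearMap.coe_mk, AddHom.coe_mk, map_mul, Matrix.mul_apply, Fin.sum_univ_two]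
  rw [(deltaHom_diag a).1, (deltaHom_diag b).2.2, add_comm]

theorem delta_algebraMap (c : 𝕜) : delta 𝕜 g (algebraMap 𝕜 _ c) = 0 := by
  change deltaHom 𝕜 g (algebraMap 𝕜 _ c) 0 1 = 0
  rw [AlgHom.commutes]
  simp [Matrix.algebraMap_matrix_apply]

theorem delta_one : delta 𝕜 g 1 = 0 := by
  rw [← map_one (algebraMap 𝕜 _)]; exact delta_algebraMap 1

theorem delta_inl (j : Fin g) : delta 𝕜 g (monomial 𝕜 (FreeMonoid.of (Sum.inl j))) = 0 := by
  simp [delta, deltaHom_letter, letterMatrix]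

theorem delta_inr (j : Fin g) : delta 𝕜 g (monomial 𝕜 (FreeMonoid.of (Sum.inr j))) =
    monomial 𝕜 (FreeMonoid.of (Sum.inr j)) ⊗ₜ 1 - 1 ⊗ₜ monomial 𝕜 (FreeMonoid.of (Sum.inr j)) := by
  simp [delta, deltaHom_letter, letterMatrix]

theorem delta_analytic {p : FreeStarAlgebra 𝕜 g} (hp : p ∈ analytic 𝕜 g) : delta 𝕜 g p = 0 := by
  induction hp using Algebra.adjoin_induction with
  | mem x hx => obtain ⟨j, rfl⟩ := hx; exact delta_inl j
  | algebraMap c => exact delta_algebraMap c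
  | add p q _ _ hp hq => rw [map_add, hp, hq, add_zero]
  | mul p q _ _ hp hq => rw [delta_mul, hp, hq, zero_mul, mul_zero, add_zero]

theorem star_algebraMap' (c : 𝕜) : star (algebraMap 𝕜 (FreeStarAlgebra 𝕜 g) c) =
    algebraMap 𝕜 _ (star c) := by
  rw [Algebra.algebraMap_eq_smul_one, star_smul, star_one, Algebra.algebraMap_eq_smul_one]

/-- On the algebra generated by the `x_j^*`, `δ` is the inner derivation given by `1 ⊗ 1`: in a
product the middle terms cancel. -/
theorem delta_star_analytic {p : FreeStarAlgebra 𝕜 g} (hp : p ∈ analytic 𝕜 g) :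
    delta 𝕜 g (star p) = star p ⊗ₜ 1 - 1 ⊗ₜ star p := by
  induction hp using Algebra.adjoin_induction with
  | mem x hx =>
    obtain ⟨j, rfl⟩ := hx
    have : star (FreeStarAlgebra.x 𝕜 j) = monomial 𝕜 (FreeMonoid.of (Sum.inr j)) := by
      simp [FreeStarAlgebra.x, star_single, monomial, StarWord.adjoint]
    rw [this, delta_inr]
  | algebraMap c =>
    rw [star_algebraMap', delta_algebraMap, Algebra.algebraMap_eq_smul_one,
      TensorProduct.smul_tmul, sub_self]
  | add p q _ _ hp hq =>
    rw [star_add, map_add, hp, hq, TensorProduct.add_tmul, TensorProduct.tmul_add]; abel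
  | mul p q _ _ hp hq =>
    rw [star_mul, delta_mul, hp, hq]
    simp [sub_mul, mul_sub]

/-! ### Compatibility of the derivation with the ideal. -/

/-- The kernel of `A ⊗ A → A/I ⊗ A/I`. -/
noncomputable def tensorKer (I : Ideal (FreeStarAlgebra 𝕜 g)) :
    Submodule 𝕜 (FreeStarAlgebra 𝕜 g ⊗[𝕜] FreeStarAlgebra 𝕜 g) :=
  Submodule.span 𝕜 {t | ∃ p q, (p ∈ I ∨ q ∈ I) ∧ t = p ⊗ₜ q}

theorem tmul_mul_mem_tensorKer {I : Ideal (FreeStarAlgebra 𝕜 g)} (a : FreeStarAlgebra 𝕜 g)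
    {t : FreeStarAlgebra 𝕜 g ⊗[𝕜] FreeStarAlgebra 𝕜 g} (ht : t ∈ tensorKer I) :
    (a ⊗ₜ 1) * t ∈ tensorKer I := by
  induction ht using Submodule.span_induction with
  | mem t ht =>
    obtain ⟨p, q, h, rfl⟩ := ht
    refine Submodule.subset_span ⟨a * p, q, h.imp (I.mul_mem_left a) id, by simp⟩
  | zero => simp
  | add t s _ _ ht hs => rw [mul_add]; exact add_mem ht hs
  | smul c t _ ht => rw [mul_smul_comm]; exact Submodule.smul_mem _ _ ht

theorem mul_tmul_mem_tensorKer {I : Ideal (FreeStarAlgebra 𝕜 g)} (hI : IsStarIdeal I)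
    (a : FreeStarAlgebra 𝕜 g)
    {t : FreeStarAlgebra 𝕜 g ⊗[𝕜] FreeStarAlgebra 𝕜 g} (ht : t ∈ tensorKer I) :
    t * (1 ⊗ₜ a) ∈ tensorKer I := by
  induction ht using Submodule.span_induction with
  | mem t ht =>
    obtain ⟨p, q, h, rfl⟩ := ht
    refine Submodule.subset_span ⟨p, q * a, h.imp id (hI.mul_mem_right a), by simp⟩
  | zero => simp
  | add t s _ _ ht hs => rw [add_mul]; exact add_mem ht hs
  | smul c t _ ht => rw [smul_mul_assoc]; exact Submodule.smul_mem _ _ ht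

theorem mul_tmul_mem_tensorKer_of_mem {I : Ideal (FreeStarAlgebra 𝕜 g)}
    {f : FreeStarAlgebra 𝕜 g} (hf : f ∈ I)
    (t : FreeStarAlgebra 𝕜 g ⊗[𝕜] FreeStarAlgebra 𝕜 g) :
    t * (1 ⊗ₜ f) ∈ tensorKer I := by
  induction t using TensorProduct.induction_on with
  | zero => simp
  | tmul p q => exact Submodule.subset_span ⟨p, q * f, Or.inr (I.mul_mem_left q hf), by simp⟩
  | add t s ht hs => rw [add_mul]; exact add_mem ht hs

theorem tmul_mul_mem_tensorKer_of_mem {I : Ideal (FreeStarAlgebra 𝕜 g)} (hI : IsStarIdeal I)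
    {f : FreeStarAlgebra 𝕜 g} (hf : f ∈ I)
    (t : FreeStarAlgebra 𝕜 g ⊗[𝕜] FreeStarAlgebra 𝕜 g) :
    (f ⊗ₜ 1) * t ∈ tensorKer I := by
  induction t using TensorProduct.induction_on with
  | zero => simp
  | tmul p q => exact Submodule.subset_span ⟨f * p, q, Or.inl (hI.mul_mem_right p hf), by simp⟩
  | add t s ht hs => rw [mul_add]; exact add_mem ht hs

theorem subset_starIdealSpan (S : Set (FreeStarAlgebra 𝕜 g)) :
    S ⊆ (starIdealSpan S : Set (FreeStarAlgebra 𝕜 g)) := by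
  intro a ha
  simp only [starIdealSpan, SetLike.mem_coe, Submodule.mem_sInf]
  exact fun J hJ => hJ.2 ha

/-- By the Leibniz rule the condition passes to multiples from both sides, so it need only be
checked on the generators and their adjoints. -/
theorem delta_mem_tensorKer {S : Set (FreeStarAlgebra 𝕜 g)} (hS : ∀ p ∈ S, p ∈ analytic 𝕜 g)
    {f : FreeStarAlgebra 𝕜 g} (hf : f ∈ starIdealSpan S) :
    delta 𝕜 g f ∈ tensorKer (starIdealSpan S) := by
  set I := starIdealSpan S with hIdef
  have hI : IsStarIdeal I := isStarIdeal_starIdealSpan S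
  have left : ∀ a f, f ∈ I → delta 𝕜 g f ∈ tensorKer I →
      delta 𝕜 g (a * f) ∈ tensorKer I := fun a f hf h => by
    rw [delta_mul]
    exact add_mem (mul_tmul_mem_tensorKer_of_mem hf _) (tmul_mul_mem_tensorKer a h)
  have right : ∀ a f, f ∈ I → delta 𝕜 g f ∈ tensorKer I →
      delta 𝕜 g (f * a) ∈ tensorKer I := fun a f hf h => by
    rw [delta_mul]
    exact add_mem (mul_tmul_mem_tensorKer hI a h) (tmul_mul_mem_tensorKer_of_mem hI hf _)
  -- The condition is imposed on `f` and on `star f`, so that `J` is a `*`-ideal; minimality of the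
  -- span then gives `I ≤ J`.
  let J : Ideal (FreeStarAlgebra 𝕜 g) :=
    { carrier := {f | f ∈ I ∧ delta 𝕜 g f ∈ tensorKer I ∧ delta 𝕜 g (star f) ∈ tensorKer I}
      add_mem' := fun {a b} ha hb => by
        refine ⟨add_mem ha.1 hb.1, ?_, ?_⟩
        · rw [map_add]; exact add_mem ha.2.1 hb.2.1
        · rw [star_add, map_add]; exact add_mem ha.2.2 hb.2.2
      zero_mem' := by simp
      smul_mem' := fun a f hf => by
        refine ⟨I.mul_mem_left a hf.1, left a f hf.1 hf.2.1, ?_⟩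
        rw [smul_eq_mul, star_mul]
        exact right _ _ ((hI f).2 hf.1) hf.2.2 }
  have hJ : IsStarIdeal J := fun a => by
    change (star a ∈ I ∧ _ ∧ delta 𝕜 g (star (star a)) ∈ _) ↔ (a ∈ I ∧ _ ∧ _)
    rw [hI a, star_star]
    tauto
  have hSJ : S ⊆ (J : Set _) := fun p hp => by
    have hpI : p ∈ I := subset_starIdealSpan S hp
    refine ⟨hpI, ?_, ?_⟩
    · rw [delta_analytic (hS p hp)]; exact zero_mem _
    · rw [delta_star_analytic (hS p hp)]
      have := (hI p).2 hpI
      exact sub_mem (Submodule.subset_span ⟨_, _, Or.inl this, rfl⟩)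
        (Submodule.subset_span ⟨_, _, Or.inr this, rfl⟩)
  have : f ∈ J := by
    rw [hIdef] at hf
    simp only [starIdealSpan, Submodule.mem_sInf] at hf
    exact hf J ⟨hJ, hSJ⟩
  exact this.2.1

/-- This is how `δ I ⊆ I ⊗ A + A ⊗ I` is used: with `W = I` it makes an operator preserve `I`, with
`W = ⊥` it makes a functional vanish on `I`. -/
theorem lift_mem_of_mem_tensorKer {K : Type*} [AddCommGroup K] [Module 𝕜 K]
    {I : Ideal (FreeStarAlgebra 𝕜 g)} (W : Submodule 𝕜 K)
    (β : FreeStarAlgebra 𝕜 g →ₗ[𝕜] FreeStarAlgebra 𝕜 g →ₗ[𝕜] K)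
    (hl : ∀ a ∈ I, ∀ b, β a b ∈ W) (hr : ∀ a, ∀ b ∈ I, β a b ∈ W)
    {t : FreeStarAlgebra 𝕜 g ⊗[𝕜] FreeStarAlgebra 𝕜 g} (ht : t ∈ tensorKer I) :
    TensorProduct.lift β t ∈ W := by
  induction ht using Submodule.span_induction with
  | mem t ht =>
    obtain ⟨p, q, h, rfl⟩ := ht
    rcases h with h | h
    · simpa using hl p h q
    · simpa using hr p q h
  | zero => simp
  | add t s _ _ ht hs => rw [map_add]; exact add_mem ht hs
  | smul c t _ ht => rw [map_smul]; exact Submodule.smul_mem _ _ ht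

/-! ### The degree filtration -/

/-- The polynomials of degree less than `n`. -/
noncomputable def degLT (𝕜 : Type*) [RCLike 𝕜] (g n : ℕ) : Submodule 𝕜 (FreeStarAlgebra 𝕜 g) :=
  Submodule.span 𝕜 (monomial 𝕜 '' {u : StarWord g | u.length < n})

theorem monomial_mem_degLT {u : StarWord g} {n : ℕ} (h : u.length < n) :
    monomial 𝕜 u ∈ degLT 𝕜 g n :=
  Submodule.subset_span ⟨u, h, rfl⟩

theorem degLT_mono {m n : ℕ} (h : m ≤ n) : degLT 𝕜 g m ≤ degLT 𝕜 g n :=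
  Submodule.span_mono (Set.image_mono fun _ hu => lt_of_lt_of_le hu h)

theorem degLT_induction {n : ℕ} {W : Submodule 𝕜 (FreeStarAlgebra 𝕜 g)}
    (h : ∀ u : StarWord g, u.length < n → monomial 𝕜 u ∈ W) : degLT 𝕜 g n ≤ W := by
  rw [degLT, Submodule.span_le]
  rintro _ ⟨u, hu, rfl⟩
  exact h u hu

theorem exists_mem_degLT (a : FreeStarAlgebra 𝕜 g) : ∃ n, a ∈ degLT 𝕜 g n := by
  have ha : a ∈ Submodule.span 𝕜 (Set.range (monomial 𝕜 : StarWord g → _)) := by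
    rw [span_range_monomial]; trivial
  induction ha using Submodule.span_induction with
  | mem x hx => obtain ⟨u, rfl⟩ := hx; exact ⟨_, monomial_mem_degLT (Nat.lt_succ_self _)⟩
  | zero => exact ⟨0, zero_mem _⟩
  | add x y _ _ hx hy =>
    obtain ⟨m, hm⟩ := hx
    obtain ⟨n, hn⟩ := hy
    exact ⟨max m n, add_mem (degLT_mono (le_max_left _ _) hm) (degLT_mono (le_max_right _ _) hn)⟩
  | smul c x _ hx => obtain ⟨n, hn⟩ := hx; exact ⟨n, Submodule.smul_mem _ _ hn⟩

theorem length_adjoint (u : StarWord g) : u.adjoint.length = u.length := by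
  induction u using FreeMonoid.recOn with
  | one => rfl
  | of_mul e u ih =>
    rw [StarWord.adjoint_mul, FreeMonoid.length_mul, FreeMonoid.length_mul, ih, add_comm]
    rfl

theorem star_mem_degLT {n : ℕ} {a : FreeStarAlgebra 𝕜 g} (ha : a ∈ degLT 𝕜 g n) :
    star a ∈ degLT 𝕜 g n := by
  induction ha using Submodule.span_induction with
  | mem x hx =>
    obtain ⟨u, hu, rfl⟩ := hx
    rw [star_monomial]
    exact monomial_mem_degLT (by rwa [length_adjoint])
  | zero => simp
  | add x y _ _ hx hy => rw [star_add]; exact add_mem hx hy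
  | smul c x _ hx => rw [star_smul]; exact Submodule.smul_mem _ _ hx

theorem mul_mem_degLT {m n k : ℕ} {a b : FreeStarAlgebra 𝕜 g} (ha : a ∈ degLT 𝕜 g (m + 1))
    (hb : b ∈ degLT 𝕜 g (n + 1)) (hk : m + n + 1 ≤ k) : a * b ∈ degLT 𝕜 g k := by
  induction ha, hb using Submodule.span_induction₂ with
  | mem_mem x y hx hy =>
    obtain ⟨u, hu, rfl⟩ := hx
    obtain ⟨v, hv, rfl⟩ := hy
    rw [← monomial_mul]
    simp only [Set.mem_ofPred_eq] at hu hv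
    exact monomial_mem_degLT (by rw [FreeMonoid.length_mul]; omega)
  | zero_left => simp
  | zero_right => simp
  | add_left x y z _ _ _ hx hy => rw [add_mul]; exact add_mem hx hy
  | add_right x y z _ _ _ hx hy => rw [mul_add]; exact add_mem hx hy
  | smul_left c x y _ _ h => rw [smul_mul_assoc]; exact Submodule.smul_mem _ _ h
  | smul_right c x y _ _ h => rw [mul_smul_comm]; exact Submodule.smul_mem _ _ h

instance finiteDimensional_degLT (n : ℕ) : FiniteDimensional 𝕜 (degLT 𝕜 g n) := by
  have : {u : StarWord g | u.length < n}.Finite := List.finite_length_lt (Fin g ⊕ Fin g) n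
  exact FiniteDimensional.span_of_finite 𝕜 (this.image _)

/-! ### Degrees of the terms of the derivation -/

/-- The span of the tensors of words whose lengths satisfy `R`. -/
noncomputable def tensorSpan (𝕜 : Type*) [RCLike 𝕜] (g : ℕ) (R : ℕ → ℕ → Prop) :
    Submodule 𝕜 (FreeStarAlgebra 𝕜 g ⊗[𝕜] FreeStarAlgebra 𝕜 g) :=
  Submodule.span 𝕜 {t | ∃ p q : StarWord g, R p.length q.length ∧
    t = monomial 𝕜 p ⊗ₜ monomial 𝕜 q}

theorem tmul_mul_mem_tensorSpan {R R' : ℕ → ℕ → Prop} (u : StarWord g)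
    (h : ∀ i j, R i j → R' (u.length + i) j) {t} (ht : t ∈ tensorSpan 𝕜 g R) :
    (monomial 𝕜 u ⊗ₜ 1) * t ∈ tensorSpan 𝕜 g R' := by
  induction ht using Submodule.span_induction with
  | mem t ht =>
    obtain ⟨p, q, hR, rfl⟩ := ht
    refine Submodule.subset_span ⟨u * p, q, ?_, by simp [monomial_mul]⟩
    rw [FreeMonoid.length_mul]
    exact h _ _ hR
  | zero => simp
  | add t s _ _ ht hs => rw [mul_add]; exact add_mem ht hs
  | smul c t _ ht => rw [mul_smul_comm]; exact Submodule.smul_mem _ _ ht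

theorem mul_tmul_mem_tensorSpan {R R' : ℕ → ℕ → Prop} (u : StarWord g)
    (h : ∀ i j, R i j → R' i (j + u.length)) {t} (ht : t ∈ tensorSpan 𝕜 g R) :
    t * (1 ⊗ₜ monomial 𝕜 u) ∈ tensorSpan 𝕜 g R' := by
  induction ht using Submodule.span_induction with
  | mem t ht =>
    obtain ⟨p, q, hR, rfl⟩ := ht
    refine Submodule.subset_span ⟨p, q * u, ?_, by simp [monomial_mul]⟩
    rw [FreeMonoid.length_mul]
    exact h _ _ hR
  | zero => simp
  | add t s _ _ ht hs => rw [add_mul]; exact add_mem ht hs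
  | smul c t _ ht => rw [smul_mul_assoc]; exact Submodule.smul_mem _ _ ht

theorem lift_mem_of_mem_tensorSpan {K : Type*} [AddCommGroup K] [Module 𝕜 K] (W : Submodule 𝕜 K)
    (β : FreeStarAlgebra 𝕜 g →ₗ[𝕜] FreeStarAlgebra 𝕜 g →ₗ[𝕜] K) {R : ℕ → ℕ → Prop}
    (h : ∀ p q : StarWord g, R p.length q.length → β (monomial 𝕜 p) (monomial 𝕜 q) ∈ W)
    {t} (ht : t ∈ tensorSpan 𝕜 g R) : TensorProduct.lift β t ∈ W := by
  induction ht using Submodule.span_induction with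
  | mem t ht => obtain ⟨p, q, hR, rfl⟩ := ht; simpa using h p q hR
  | zero => simp
  | add t s _ _ ht hs => rw [map_add]; exact add_mem ht hs
  | smul c t _ ht => rw [map_smul]; exact Submodule.smul_mem _ _ ht

/-- The indicator of the letters `x_j^*`. -/
noncomputable def adjointSign (𝕜 : Type*) [RCLike 𝕜] {g : ℕ} (e : Fin g ⊕ Fin g) : 𝕜 :=
  Sum.elim (fun _ => 0) (fun _ => 1) e

theorem delta_letter (e : Fin g ⊕ Fin g) : delta 𝕜 g (monomial 𝕜 (FreeMonoid.of e)) =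
    adjointSign 𝕜 e • (monomial 𝕜 (FreeMonoid.of e) ⊗ₜ 1 - 1 ⊗ₜ monomial 𝕜 (FreeMonoid.of e)) := by
  rcases e with j | j
  · simp [delta_inl, adjointSign]
  · simp [delta_inr, adjointSign]

theorem delta_monomial_mem (u : StarWord g) :
    delta 𝕜 g (monomial 𝕜 u) ∈ tensorSpan 𝕜 g fun i j => i + j = u.length := by
  induction u using FreeMonoid.recOn with
  | one => rw [monomial_one, delta_one]; exact zero_mem _
  | of_mul e u ih =>
    rw [monomial_mul, delta_mul, FreeMonoid.length_mul]
    refine add_mem (mul_tmul_mem_tensorSpan u (R := fun i j => i + j = 1) ?_ ?_)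
      (tmul_mul_mem_tensorSpan _ ?_ ih)
    · intro i j h; simp only [FreeMonoid.length_of]; omega
    · rw [delta_letter]
      refine Submodule.smul_mem _ _ (sub_mem (Submodule.subset_span ?_) (Submodule.subset_span ?_))
      · exact ⟨FreeMonoid.of e, 1, by simp, rfl⟩
      · exact ⟨1, FreeMonoid.of e, by simp, rfl⟩
    · intro i j h; simp only [FreeMonoid.length_of]; omega

/-- Only the first letter can contribute a term with empty left factor, and it does so exactly when
it is some `x_j^*`. -/
theorem delta_of_mul_mem (e : Fin g ⊕ Fin g) (u : StarWord g) :
    delta 𝕜 g (monomial 𝕜 (FreeMonoid.of e * u))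
      + adjointSign 𝕜 e • (1 ⊗ₜ monomial 𝕜 (FreeMonoid.of e * u)) ∈
    tensorSpan 𝕜 g fun i j => 1 ≤ i ∧ i + j = u.length + 1 := by
  have : delta 𝕜 g (monomial 𝕜 (FreeMonoid.of e * u))
      + adjointSign 𝕜 e • (1 ⊗ₜ monomial 𝕜 (FreeMonoid.of e * u)) =
      adjointSign 𝕜 e • (monomial 𝕜 (FreeMonoid.of e) ⊗ₜ monomial 𝕜 u) +
      (monomial 𝕜 (FreeMonoid.of e) ⊗ₜ 1) * delta 𝕜 g (monomial 𝕜 u) := by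
    rw [monomial_mul, delta_mul, delta_letter, smul_mul_assoc, sub_mul]
    simp only [Algebra.TensorProduct.tmul_mul_tmul, mul_one, one_mul, smul_sub]
    abel
  rw [this]
  refine add_mem (Submodule.smul_mem _ _ (Submodule.subset_span ⟨_, _, ?_, rfl⟩))
    (tmul_mul_mem_tensorSpan _ ?_ (delta_monomial_mem u))
  · simp only [FreeMonoid.length_of]; omega
  · intro i j h; simp only [FreeMonoid.length_of]; omega

/-- Mirror image: an empty right factor can come only from the last letter. -/
theorem delta_mul_of_mem (e : Fin g ⊕ Fin g) (u : StarWord g) :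
    delta 𝕜 g (monomial 𝕜 (u * FreeMonoid.of e))
      - adjointSign 𝕜 e • (monomial 𝕜 (u * FreeMonoid.of e) ⊗ₜ 1) ∈
    tensorSpan 𝕜 g fun i j => 1 ≤ j ∧ i + j = u.length + 1 := by
  have : delta 𝕜 g (monomial 𝕜 (u * FreeMonoid.of e))
      - adjointSign 𝕜 e • (monomial 𝕜 (u * FreeMonoid.of e) ⊗ₜ 1) =
      delta 𝕜 g (monomial 𝕜 u) * (1 ⊗ₜ monomial 𝕜 (FreeMonoid.of e)) -
      adjointSign 𝕜 e • (monomial 𝕜 u ⊗ₜ monomial 𝕜 (FreeMonoid.of e)) := by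
    rw [monomial_mul, delta_mul, delta_letter, mul_smul_comm, mul_sub]
    simp only [Algebra.TensorProduct.tmul_mul_tmul, mul_one, one_mul, smul_sub]
    abel
  rw [this]
  refine sub_mem (mul_tmul_mem_tensorSpan _ ?_ (delta_monomial_mem u))
    (Submodule.smul_mem _ _ (Submodule.subset_span ⟨_, _, ?_, rfl⟩))
  · intro i j h; simp only [FreeMonoid.length_of]; omega
  · exact ⟨by simp, by simp⟩

/-! ### Splitting off the words that start with some `x_j^*` -/

/-- Minus the contraction of the derivation with a functional: modulo lower degrees it keeps the
words that start with some `x_j^*` and kills the others. -/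
noncomputable def adjointPart (χ : FreeStarAlgebra 𝕜 g →ₗ[𝕜] 𝕜) :
    FreeStarAlgebra 𝕜 g →ₗ[𝕜] FreeStarAlgebra 𝕜 g :=
  -(TensorProduct.lift (χ.smulRight LinearMap.id) ∘ₗ delta 𝕜 g)

theorem adjointPart_mem {I : Ideal (FreeStarAlgebra 𝕜 g)} {χ : FreeStarAlgebra 𝕜 g →ₗ[𝕜] 𝕜}
    (hχ : ∀ a ∈ I, χ a = 0) {a : FreeStarAlgebra 𝕜 g} (ha : delta 𝕜 g a ∈ tensorKer I) :
    adjointPart χ a ∈ I := by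
  refine neg_mem (lift_mem_of_mem_tensorKer (I.restrictScalars 𝕜) _ ?_ ?_ ha)
  · intro a ha b; simp [hχ a ha]
  · intro a b hb
    exact Submodule.smul_mem (I.restrictScalars 𝕜) (χ a) hb

/-- The term `1 ⊗ e u` of `δ` contracts to the word itself because `χ 1 = 1`; every other term has a
nonempty left factor, hence a shorter right factor. -/
theorem adjointPart_of_mul {χ : FreeStarAlgebra 𝕜 g →ₗ[𝕜] 𝕜} (hχ : χ 1 = 1)
    (e : Fin g ⊕ Fin g) (u : StarWord g) :
    adjointPart χ (monomial 𝕜 (FreeMonoid.of e * u))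
      - adjointSign 𝕜 e • monomial 𝕜 (FreeMonoid.of e * u) ∈ degLT 𝕜 g (u.length + 1) := by
  have h := lift_mem_of_mem_tensorSpan (degLT 𝕜 g (u.length + 1)) (χ.smulRight LinearMap.id)
    (fun p q h => Submodule.smul_mem (degLT 𝕜 g (u.length + 1)) (χ (monomial 𝕜 p))
      (monomial_mem_degLT (by omega))) (delta_of_mul_mem (𝕜 := 𝕜) e u)
  rw [← neg_mem_iff]
  convert h using 1
  simp [adjointPart, hχ]
  abel

theorem adjointPart_mem_degLT {χ : FreeStarAlgebra 𝕜 g →ₗ[𝕜] 𝕜} (hχ : χ 1 = 1) {n : ℕ}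
    {a : FreeStarAlgebra 𝕜 g} (ha : a ∈ degLT 𝕜 g n) : adjointPart χ a ∈ degLT 𝕜 g n := by
  refine degLT_induction (W := (degLT 𝕜 g n).comap (adjointPart χ)) ?_ ha
  intro u hu
  rw [Submodule.mem_comap]
  induction u using FreeMonoid.casesOn with
  | one => simp [adjointPart, monomial_one, delta_one]
  | of_mul e u =>
    have h := adjointPart_of_mul hχ e u
    rw [FreeMonoid.length_mul, FreeMonoid.length_of] at hu
    have h2 := add_mem (degLT_mono (by omega : u.length + 1 ≤ n) h)
      (Submodule.smul_mem _ (adjointSign 𝕜 e) (monomial_mem_degLT (𝕜 := 𝕜)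
        (u := FreeMonoid.of e * u) (n := n) (by simpa using hu)))
    simpa using h2

/-! ### Functionals that are positive in one degree -/

/-- `δ` preserves total length, so below `2 * d` one of the two factors has length less than `d`. -/
theorem lift_delta_eq_zero {d : ℕ}
    {β : FreeStarAlgebra 𝕜 g →ₗ[𝕜] FreeStarAlgebra 𝕜 g →ₗ[𝕜] 𝕜}
    (hl : ∀ a ∈ degLT 𝕜 g d, ∀ b, β a b = 0) (hr : ∀ a, ∀ b ∈ degLT 𝕜 g d, β a b = 0)
    {a : FreeStarAlgebra 𝕜 g} (ha : a ∈ degLT 𝕜 g (2 * d)) :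
    TensorProduct.lift β (delta 𝕜 g a) = 0 := by
  refine degLT_induction (W := LinearMap.ker (TensorProduct.lift β ∘ₗ delta 𝕜 g)) ?_ ha
  intro u hu
  refine lift_mem_of_mem_tensorSpan ⊥ β (fun p q h => ?_) (delta_monomial_mem u)
  rw [Submodule.mem_bot]
  by_cases hp : p.length < d
  · exact hl _ (monomial_mem_degLT hp) _
  · exact hr _ _ (monomial_mem_degLT (by omega))

/-- In the product of two words of length `d`, `β` sees only the cut in the middle. The last letter
of the left word contributes there with sign `+`, the first letter of the right word with sign `-`.
-/
theorem lift_delta_mul {d : ℕ}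
    {β : FreeStarAlgebra 𝕜 g →ₗ[𝕜] FreeStarAlgebra 𝕜 g →ₗ[𝕜] 𝕜}
    (hl : ∀ a ∈ degLT 𝕜 g d, ∀ b, β a b = 0) (hr : ∀ a, ∀ b ∈ degLT 𝕜 g d, β a b = 0)
    (e f : Fin g ⊕ Fin g) (u v : StarWord g) (hu : u.length + 1 = d) (hv : v.length + 1 = d) :
    TensorProduct.lift β (delta 𝕜 g
      (monomial 𝕜 (u * FreeMonoid.of e) * monomial 𝕜 (FreeMonoid.of f * v))) =
    (adjointSign 𝕜 e - adjointSign 𝕜 f) *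
      β (monomial 𝕜 (u * FreeMonoid.of e)) (monomial 𝕜 (FreeMonoid.of f * v)) := by
  have h1 := mul_tmul_mem_tensorSpan (R' := fun i j => i < d) (FreeMonoid.of f * v)
    (fun i j h => by omega) (delta_mul_of_mem (𝕜 := 𝕜) e u)
  have h2 := tmul_mul_mem_tensorSpan (R' := fun i j => j < d) (u * FreeMonoid.of e)
    (fun i j h => by omega) (delta_of_mul_mem (𝕜 := 𝕜) f v)
  have h1' := lift_mem_of_mem_tensorSpan ⊥ β
    (fun p q h => by rw [Submodule.mem_bot]; exact hl _ (monomial_mem_degLT h) _) h1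
  have h2' := lift_mem_of_mem_tensorSpan ⊥ β
    (fun p q h => by rw [Submodule.mem_bot]; exact hr _ _ (monomial_mem_degLT h)) h2
  rw [Submodule.mem_bot] at h1' h2'
  rw [delta_mul, map_add]
  simp only [sub_mul, mul_add, map_sub, map_add, smul_mul_assoc, mul_smul_comm,
    Algebra.TensorProduct.tmul_mul_tmul, one_mul, mul_one, map_smul, TensorProduct.lift.tmul,
    smul_eq_mul] at h1' h2'
  linear_combination h1' + h2'

end FreeStarAlgebra

/-- Pull back the standard inner product in the coordinates of a basis of `V ⧸ N`. -/
theorem Submodule.exists_sesqForm_ker {𝕜 V : Type*} [RCLike 𝕜] [AddCommGroup V] [Module 𝕜 V]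
    (N : Submodule 𝕜 V) : ∃ h : V →ₗ⋆[𝕜] V →ₗ[𝕜] 𝕜, (∀ a ∈ N, h a = 0) ∧
      (∀ a, ∀ b ∈ N, h a b = 0) ∧
      ∀ a, 0 ≤ RCLike.re (h a a) ∧ (RCLike.re (h a a) = 0 → a ∈ N) := by
  let b := Module.Basis.ofVectorSpace 𝕜 (V ⧸ N)
  let r : V →ₗ[𝕜] _ := b.repr.toLinearMap ∘ₗ N.mkQ
  have hr : ∀ a, r a = 0 ↔ a ∈ N := fun a => by simp [r]
  let h : V →ₗ⋆[𝕜] V →ₗ[𝕜] 𝕜 := LinearMap.mk₂'ₛₗ (starRingEnd 𝕜) (RingHom.id 𝕜)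
    (fun v w => (r w).sum fun i c => c * starRingEnd 𝕜 (r v i))
    (fun v v' w => by simp [Finsupp.sum, mul_add, Finset.sum_add_distrib])
    (fun c v w => by
      simp only [Finsupp.sum, map_smul, Finsupp.smul_apply, smul_eq_mul, map_mul, Finset.mul_sum]
      exact Finset.sum_congr rfl fun i _ => by ring)
    (fun v w w' => by
      rw [map_add, Finsupp.sum_add_index' (by simp) fun i c c' => add_mul _ _ _])
    (fun c v w => by
      rw [map_smul, Finsupp.sum_smul_index (by simp), RingHom.id_apply, smul_eq_mul,
        Finsupp.mul_sum]
      exact Finset.sum_congr rfl fun i _ => by ring)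
  have hh : ∀ v w, h v w = (r w).sum fun i c => c * starRingEnd 𝕜 (r v i) := fun v w => rfl
  have hre : ∀ a, RCLike.re (h a a) = ∑ i ∈ (r a).support, ‖r a i‖ ^ 2 := fun a => by
    rw [hh, Finsupp.sum, map_sum]
    refine Finset.sum_congr rfl fun i _ => ?_
    rw [RCLike.mul_conj]
    norm_cast
  refine ⟨h, fun a ha => ?_, fun a b hb => ?_, fun a => ⟨?_, fun h0 => ?_⟩⟩
  · ext w
    rw [hh, (hr a).2 ha]
    simp
  · rw [hh, (hr b).2 hb]
    simp
  · rw [hre]; positivity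
  · rw [hre, Finset.sum_eq_zero_iff_of_nonneg (fun _ _ => by positivity)] at h0
    rw [← hr]
    ext i
    by_cases hi : i ∈ (r a).support
    · simpa using h0 i hi
    · simpa using hi

namespace FreeStarAlgebra

variable {𝕜 : Type*} [RCLike 𝕜] {g : ℕ}

theorem adjointSign_swap (e : Fin g ⊕ Fin g) : adjointSign 𝕜 e.swap = 1 - adjointSign 𝕜 e := by
  rcases e with j | j <;> simp [adjointSign]

/-- A functional on `A / I` that vanishes below degree `2 d` and is positive in degree `2 d`. -/
theorem exists_functional_of_degree {I : Ideal (FreeStarAlgebra 𝕜 g)} (hI : IsStarIdeal I)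
    (hδ : ∀ f ∈ I, delta 𝕜 g f ∈ tensorKer I) (h1 : (1 : FreeStarAlgebra 𝕜 g) ∉ I) {d : ℕ}
    (hd : 1 ≤ d) : ∃ M : FreeStarAlgebra 𝕜 g →ₗ[𝕜] 𝕜, (∀ a ∈ I, M a = 0) ∧
      (∀ a ∈ degLT 𝕜 g (2 * d), M a = 0) ∧
      ∀ a ∈ degLT 𝕜 g (d + 1), 0 ≤ RCLike.re (M (star a * a)) ∧
        (RCLike.re (M (star a * a)) = 0 → a ∈ I.restrictScalars 𝕜 ⊔ degLT 𝕜 g d) := by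
  obtain ⟨χ, hχ1, hχI⟩ : ∃ χ : FreeStarAlgebra 𝕜 g →ₗ[𝕜] 𝕜, χ 1 = 1 ∧ ∀ a ∈ I, χ a = 0 := by
    obtain ⟨f, hf, hfI⟩ := Submodule.exists_le_ker_of_notMem (p := I.restrictScalars 𝕜) h1
    refine ⟨(f 1)⁻¹ • f, by simp [hf], fun a ha => ?_⟩
    simp [LinearMap.mem_ker.1 (hfI ha)]
  obtain ⟨h, hl, hr, hpos⟩ := (I.restrictScalars 𝕜 ⊔ degLT 𝕜 g d).exists_sesqForm_ker
  set T := adjointPart χ with hT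
  set U := LinearMap.id - T with hU
  have hTI : ∀ a ∈ I, T a ∈ I := fun a ha => adjointPart_mem hχI (hδ a ha)
  have hTF : ∀ n, ∀ a ∈ degLT 𝕜 g n, T a ∈ degLT 𝕜 g n := fun n a ha =>
    adjointPart_mem_degLT hχ1 ha
  have hUI : ∀ a ∈ I, U a ∈ I := fun a ha => sub_mem ha (hTI a ha)
  have hUF : ∀ n, ∀ a ∈ degLT 𝕜 g n, U a ∈ degLT 𝕜 g n := fun n a ha => sub_mem ha (hTF n a ha)
  have hlI : ∀ a ∈ I, h a = 0 := fun a ha => hl a (Submodule.mem_sup_left ha)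
  have hrI : ∀ a, ∀ b ∈ I, h a b = 0 := fun a b hb => hr a b (Submodule.mem_sup_left hb)
  have hlF : ∀ a ∈ degLT 𝕜 g d, h a = 0 := fun a ha => hl a (Submodule.mem_sup_right ha)
  have hrF : ∀ a, ∀ b ∈ degLT 𝕜 g d, h a b = 0 := fun a b hb => hr a b (Submodule.mem_sup_right hb)
  -- The minus sign offsets the factor `-1` that `lift_delta_mul` produces when both words `u`, `v`
  -- in `u^* v` start with adjoint letters.
  let β : FreeStarAlgebra 𝕜 g →ₗ[𝕜] FreeStarAlgebra 𝕜 g →ₗ[𝕜] 𝕜 :=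
    LinearMap.mk₂ 𝕜 (fun a b => h (U (star a)) (U b) - h (T (star a)) (T b))
      (fun a a' b => by simp only [star_add, map_add, LinearMap.add_apply]; ring)
      (fun c a b => by
        simp only [star_smul, map_smul, map_smulₛₗ, LinearMap.smul_apply, smul_eq_mul,
          starRingEnd_apply, star_star]; ring)
      (fun a b b' => by simp only [map_add]; ring)
      (fun c a b => by simp only [map_smul, smul_eq_mul]; ring)
  have hβ : ∀ a b, β a b = h (U (star a)) (U b) - h (T (star a)) (T b) := fun a b => rfl
  have hβl : ∀ a ∈ degLT 𝕜 g d, ∀ b, β a b = 0 := fun a ha b => by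
    have := star_mem_degLT ha
    rw [hβ, hlF _ (hUF d _ this), hlF _ (hTF d _ this)]
    simp
  have hβr : ∀ a, ∀ b ∈ degLT 𝕜 g d, β a b = 0 := fun a b hb => by
    rw [hβ, hrF _ _ (hUF d _ hb), hrF _ _ (hTF d _ hb), sub_zero]
  let M : FreeStarAlgebra 𝕜 g →ₗ[𝕜] 𝕜 := TensorProduct.lift β ∘ₗ delta 𝕜 g
  have hM0 : ∀ a ∈ degLT 𝕜 g (2 * d), M a = 0 := fun a ha => lift_delta_eq_zero hβl hβr ha
  have hTw : ∀ e (u : StarWord g), u.length + 1 = d →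
      T (monomial 𝕜 (FreeMonoid.of e * u)) - adjointSign 𝕜 e • monomial 𝕜 (FreeMonoid.of e * u)
        ∈ degLT 𝕜 g d := fun e u hu => by
    have := adjointPart_of_mul hχ1 e u
    rwa [hu] at this
  have hword : ∀ u v : StarWord g, u.length < d + 1 → v.length < d + 1 →
      M (star (monomial 𝕜 u) * monomial 𝕜 v) =
        h (U (monomial 𝕜 u)) (U (monomial 𝕜 v)) + h (T (monomial 𝕜 u)) (T (monomial 𝕜 v)) := by
    intro u v hu hv
    by_cases hud : u.length < d
    · have hm := monomial_mem_degLT (𝕜 := 𝕜) hud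
      rw [hlF _ (hUF d _ hm), hlF _ (hTF d _ hm), star_monomial, ← monomial_mul, hM0]
      · simp
      · exact monomial_mem_degLT (by rw [FreeMonoid.length_mul, length_adjoint]; omega)
    by_cases hvd : v.length < d
    · have hm := monomial_mem_degLT (𝕜 := 𝕜) hvd
      rw [hrF _ _ (hUF d _ hm), hrF _ _ (hTF d _ hm), star_monomial, ← monomial_mul, hM0]
      · simp
      · exact monomial_mem_degLT (by rw [FreeMonoid.length_mul, length_adjoint]; omega)
    induction u using FreeMonoid.casesOn with
    | one => simp at hud; omega
    | of_mul e u =>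
    induction v using FreeMonoid.casesOn with
    | one => simp at hvd; omega
    | of_mul f v =>
    rw [FreeMonoid.length_mul, FreeMonoid.length_of] at hu hv hud hvd
    have hu' : u.length + 1 = d := by omega
    have hv' : v.length + 1 = d := by omega
    have hstar : star (monomial 𝕜 (FreeMonoid.of e * u)) =
        monomial 𝕜 (StarWord.adjoint u * FreeMonoid.of e.swap) := by
      rw [star_monomial, StarWord.adjoint_mul]; rfl
    have hMw := lift_delta_mul hβl hβr e.swap f (StarWord.adjoint u) v
      (by rw [length_adjoint]; exact hu') hv'
    rw [← hstar, adjointSign_swap, hβ, star_star] at hMw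
    have hl1 := hlF _ (hTw e u hu')
    have hr1 := fun a => hrF a _ (hTw f v hv')
    change M _ = _ at hMw
    rw [hMw]
    rw [map_sub, sub_eq_zero, map_smulₛₗ] at hl1
    simp only [map_sub, sub_eq_zero, map_smul] at hr1
    simp only [hU, LinearMap.sub_apply, LinearMap.id_apply, map_sub, hl1, hr1,
      LinearMap.smul_apply, smul_eq_mul]
    -- The factor is `1 - s(e) - s(f)`, with `s` the indicator of adjoint letters: `1` leaves the
    -- `U` term, `-1` the `T` term, and in the mixed cases both sides vanish.
    rcases e with e | e <;> rcases f with f | f <;> simp [adjointSign]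
  have hbil : ∀ a ∈ degLT 𝕜 g (d + 1), ∀ b ∈ degLT 𝕜 g (d + 1),
      M (star a * b) = h (U a) (U b) + h (T a) (T b) := by
    intro a ha b hb
    induction ha, hb using Submodule.span_induction₂ with
    | mem_mem x y hx hy =>
      obtain ⟨u, hu, rfl⟩ := hx
      obtain ⟨v, hv, rfl⟩ := hy
      exact hword u v hu hv
    | zero_left => simp
    | zero_right => simp
    | add_left x y z _ _ _ hx hy =>
      simp only [star_add, add_mul, map_add, hx, hy, LinearMap.add_apply]; ring
    | add_right x y z _ _ _ hx hy => simp only [mul_add, map_add, hx, hy]; ring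
    | smul_left c x y _ _ h =>
      simp only [star_smul, smul_mul_assoc, map_smul, map_smulₛₗ, h, LinearMap.smul_apply,
        smul_eq_mul, starRingEnd_apply]; ring
    | smul_right c x y _ _ h => simp only [mul_smul_comm, map_smul, h, smul_eq_mul]; ring
  refine ⟨M, fun a ha => ?_, hM0, fun a ha => ?_⟩
  · refine lift_mem_of_mem_tensorKer ⊥ β (fun a ha b => ?_) (fun a b hb => ?_) (hδ a ha)
    · have := (hI a).2 ha
      rw [Submodule.mem_bot, hβ, hlI _ (hUI _ this), hlI _ (hTI _ this)]
      simp
    · rw [Submodule.mem_bot, hβ, hrI _ _ (hUI _ hb), hrI _ _ (hTI _ hb), sub_zero]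
  · rw [hbil a ha a ha, map_add]
    refine ⟨add_nonneg (hpos _).1 (hpos _).1, fun h0 => ?_⟩
    rw [add_eq_zero_iff_of_nonneg (hpos _).1 (hpos _).1] at h0
    -- `U a` and `T a` both lie in the kernel of `h`, and they add up to `a`.
    have := add_mem ((hpos _).2 h0.1) ((hpos _).2 h0.2)
    simpa [hU] using this

end FreeStarAlgebra

/-! ### Finsler's lemma and positivity modulo an ideal. -/

/-- Finsler's lemma: a form that is positive on the zeros of a positive semidefinite form becomes
positive after adding a large multiple of the latter. -/
theorem exists_forall_pos_add_mul {E : Type*} [NormedAddCommGroup E] [NormedSpace ℝ E]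
    [ProperSpace E] {f m : E → ℝ} (hf : Continuous f) (hm : Continuous m)
    (hf2 : ∀ (r : ℝ) v, f (r • v) = r ^ 2 * f v) (hm2 : ∀ (r : ℝ) v, m (r • v) = r ^ 2 * m v)
    (hm0 : ∀ v, 0 ≤ m v) (h : ∀ v, v ≠ 0 → m v = 0 → 0 < f v) :
    ∃ γ : ℝ, ∀ v, v ≠ 0 → 0 < f v + γ * m v := by
  -- The open sets where `f + k m > 0` increase with `k` and cover the compact unit sphere, so one
  -- `k` suffices; homogeneity does the rest.
  obtain ⟨k, hk⟩ := (isCompact_sphere (0 : E) 1).elim_directed_cover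
    (fun k : ℕ => {v | 0 < f v + k * m v})
    (fun k => isOpen_lt continuous_const (hf.add (continuous_const.mul hm)))
    (fun v hv => by
      have hv0 : v ≠ 0 := ne_zero_of_mem_unit_sphere (⟨v, hv⟩ : Metric.sphere (0 : E) 1)
      rw [Set.mem_iUnion]
      rcases (hm0 v).eq_or_lt with h0 | h0
      · exact ⟨0, by simpa using h v hv0 h0.symm⟩
      · obtain ⟨k, hk⟩ := exists_nat_gt (-f v / m v)
        refine ⟨k, ?_⟩
        rw [div_lt_iff₀ h0] at hk
        change 0 < f v + k * m v
        linarith)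
    (Monotone.directed_le fun k l hkl v hv => by
      have : (k : ℝ) * m v ≤ l * m v :=
        mul_le_mul_of_nonneg_right (by exact_mod_cast hkl) (hm0 v)
      have hv' : 0 < f v + k * m v := hv
      change 0 < f v + l * m v
      linarith)
  refine ⟨k, fun v hv => ?_⟩
  have hn : 0 < ‖v‖ := norm_pos_iff.2 hv
  have h1 : ‖v‖⁻¹ • v ∈ Metric.sphere (0 : E) 1 := by
    simp [norm_smul, hn.ne']
  have h2 : 0 < f (‖v‖⁻¹ • v) + k * m (‖v‖⁻¹ • v) := hk h1
  rw [hf2, hm2] at h2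
  have h3 : ‖v‖⁻¹ ^ 2 * f v + k * (‖v‖⁻¹ ^ 2 * m v) = ‖v‖⁻¹ ^ 2 * (f v + k * m v) := by ring
  rw [h3] at h2
  exact (mul_pos_iff_of_pos_left (by positivity)).1 h2

theorem continuous_re_functional_star_mul_self {𝕜 A : Type*} [RCLike 𝕜] [Ring A] [StarRing A]
    [Algebra 𝕜 A] [StarModule 𝕜 A] (L : A →ₗ[𝕜] 𝕜) {ι : Type*} [Fintype ι] (e : ι → A) :
    Continuous fun t : ι → 𝕜 =>
      RCLike.re (L (star (∑ i, t i • e i) * ∑ i, t i • e i)) := by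
  simp only [star_sum, Finset.sum_mul, Finset.mul_sum, star_smul, smul_mul_assoc, mul_smul_comm,
    map_sum, map_smul, smul_eq_mul]
  fun_prop

/-- The cross terms lie in `I`, which is two-sided, so the quadratic form of `L` descends to `A/I`.
-/
theorem IsStarIdeal.map_star_add_mul_add {𝕜 A : Type*} [RCLike 𝕜] [Ring A] [StarRing A]
    [Algebra 𝕜 A] {I : Ideal A} (hI : IsStarIdeal I) {L : A →ₗ[𝕜] 𝕜} (hL : ∀ a ∈ I, L a = 0)
    {i : A} (hi : i ∈ I) (w : A) : L (star (i + w) * (i + w)) = L (star w * w) := by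
  rw [mul_add, map_add, hL _ (I.mul_mem_left _ hi), star_add, add_mul, map_add,
    hL _ (hI.mul_mem_right w ((hI i).2 hi)), zero_add, zero_add]

/-- Positivity modulo a `*`-ideal is gained by adding a large multiple of a functional. -/
theorem exists_pos_functional_add_smul {𝕜 A : Type*} [RCLike 𝕜] [Ring A] [StarRing A]
    [Algebra 𝕜 A] [StarModule 𝕜 A] {I : Ideal A} (hI : IsStarIdeal I) (P : Submodule 𝕜 A)
    [FiniteDimensional 𝕜 P] {L M : A →ₗ[𝕜] 𝕜} (hL : ∀ a ∈ I, L a = 0) (hM : ∀ a ∈ I, M a = 0)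
    (hM0 : ∀ a ∈ P, 0 ≤ RCLike.re (M (star a * a)))
    (hLM : ∀ a ∈ P, a ∉ I → RCLike.re (M (star a * a)) = 0 → 0 < RCLike.re (L (star a * a))) :
    ∃ γ : 𝕜, ∀ a ∈ P, a ∉ I → 0 < RCLike.re ((L + γ • M) (star a * a)) := by
  -- `W` is a complement of `I ⊓ P` in `P`. On it nonzero means outside `I`, and in coordinates it
  -- is a finite-dimensional space on which Finsler's lemma applies.
  obtain ⟨W', hW'⟩ := (I.restrictScalars 𝕜 ⊓ P).exists_isCompl
  set W := W' ⊓ P with hW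
  have hWP : W ≤ P := inf_le_right
  have hsup : (I.restrictScalars 𝕜 ⊓ P) ⊔ W = P := by
    rw [hW, ← sup_inf_assoc_of_le W' inf_le_right, hW'.sup_eq_top, top_inf_eq]
  have hWI : ∀ w ∈ W, w ∈ I → w = 0 := fun w hw hwI => by
    have := hW'.disjoint.le_bot (⟨⟨hwI, hw.2⟩, hw.1⟩ : w ∈ (I.restrictScalars 𝕜 ⊓ P) ⊓ W')
    simpa using this
  have : FiniteDimensional 𝕜 W := Submodule.finiteDimensional_of_le hWP
  let b := Module.finBasis 𝕜 W
  let φ : (Fin (Module.finrank 𝕜 W) → 𝕜) → A := fun t => ∑ i, t i • (b i : A)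
  have hφW : ∀ t, φ t ∈ W := fun t => sum_mem fun i _ => W.smul_mem _ (b i).2
  have hφ0 : ∀ t, t ≠ 0 → φ t ∉ I := fun t ht h => by
    apply ht
    have h0 := hWI _ (hφW t) h
    have h1 : ∑ i, t i • b i = 0 := by
      apply Subtype.ext
      simpa [φ] using h0
    funext i
    exact Fintype.linearIndependent_iff.1 b.linearIndependent t h1 i
  have hφr : ∀ (r : ℝ) t, φ (r • t) = (r : 𝕜) • φ t := fun r t => by
    simp [φ, Finset.smul_sum, smul_smul, RCLike.real_smul_eq_coe_mul]
  have hhom : ∀ (F : A →ₗ[𝕜] 𝕜) (r : ℝ) t, RCLike.re (F (star (φ (r • t)) * φ (r • t))) =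
      r ^ 2 * RCLike.re (F (star (φ t) * φ t)) := fun F r t => by
    rw [hφr, star_smul, smul_mul_assoc, mul_smul_comm, F.map_smul, F.map_smul, smul_eq_mul,
      smul_eq_mul, ← mul_assoc, ← starRingEnd_apply, RCLike.conj_ofReal, ← RCLike.ofReal_mul,
      RCLike.re_ofReal_mul, pow_two]
  obtain ⟨γ, hγ⟩ := exists_forall_pos_add_mul
    (continuous_re_functional_star_mul_self L fun i => (b i : A))
    (continuous_re_functional_star_mul_self M fun i => (b i : A)) (hhom L) (hhom M)
    (fun t => hM0 _ (hWP (hφW t))) (fun t ht => hLM _ (hWP (hφW t)) (hφ0 t ht))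
  refine ⟨(γ : 𝕜), fun a haP haI => ?_⟩
  rw [← hsup] at haP
  obtain ⟨i, hi, w, hw, rfl⟩ := Submodule.mem_sup.1 haP
  have hiI : i ∈ I := hi.1
  have hwt : φ (b.repr ⟨w, hw⟩) = w := by
    have := congrArg W.subtype (b.sum_repr ⟨w, hw⟩)
    rw [map_sum] at this
    exact this
  have h0 : (b.repr ⟨w, hw⟩ : _ → 𝕜) ≠ 0 := fun h0 => by
    rw [h0] at hwt
    apply haI
    rw [← hwt]
    simpa [φ] using hiI
  have := hγ _ h0
  change 0 < RCLike.re (L (star (φ _) * φ _)) + γ * RCLike.re (M (star (φ _) * φ _)) at this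
  rw [hwt] at this
  rw [LinearMap.add_apply, LinearMap.smul_apply, hI.map_star_add_mul_add hL hiI,
    hI.map_star_add_mul_add hM hiI, map_add, smul_eq_mul,
    RCLike.re_ofReal_mul]
  exact this

/-! ### A faithful positive functional, degree by degree. -/

namespace FreeStarAlgebra

variable {𝕜 : Type*} [RCLike 𝕜] {g : ℕ}

theorem exists_seq_functional {I : Ideal (FreeStarAlgebra 𝕜 g)} (hI : IsStarIdeal I)
    (hδ : ∀ f ∈ I, delta 𝕜 g f ∈ tensorKer I) (h1 : (1 : FreeStarAlgebra 𝕜 g) ∉ I) :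
    ∃ L : ℕ → FreeStarAlgebra 𝕜 g →ₗ[𝕜] 𝕜, ∀ n, (∀ a ∈ I, L n a = 0) ∧
      (∀ a ∈ degLT 𝕜 g (n + 1), a ∉ I → 0 < RCLike.re (L n (star a * a))) ∧
      ∀ a ∈ degLT 𝕜 g (2 * (n + 1)), L (n + 1) a = L n a := by
  let Good (n : ℕ) (L : FreeStarAlgebra 𝕜 g →ₗ[𝕜] 𝕜) : Prop := (∀ a ∈ I, L a = 0) ∧
      (∀ a ∈ degLT 𝕜 g (n + 1), a ∉ I → 0 < RCLike.re (L (star a * a)))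
  have base : ∃ L, Good 0 L := by
    obtain ⟨f, hf, hfI⟩ := Submodule.exists_le_ker_of_notMem (p := I.restrictScalars 𝕜) h1
    refine ⟨(f 1)⁻¹ • f, fun a ha => by simp [LinearMap.mem_ker.1 (hfI ha)], fun a ha haI => ?_⟩
    -- Degree less than `1` means scalar, so any functional normalized at `1` starts the recursion.
    have : a ∈ Submodule.span 𝕜 {(1 : FreeStarAlgebra 𝕜 g)} := by
      refine degLT_induction (fun u hu => ?_) ha
      rw [FreeMonoid.length_eq_zero.1 (Nat.lt_one_iff.1 hu)]
      exact Submodule.mem_span_singleton_self _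
    obtain ⟨c, rfl⟩ := Submodule.mem_span_singleton.1 this
    have hc : c ≠ 0 := by rintro rfl; simp at haI
    have hval : ((f 1)⁻¹ • f) (star (c • (1 : FreeStarAlgebra 𝕜 g)) * c • 1) =
        ((‖c‖ ^ 2 : ℝ) : 𝕜) := by
      rw [star_smul, star_one, smul_mul_assoc, one_mul, map_smul, map_smul, LinearMap.smul_apply,
        smul_eq_mul, smul_eq_mul, smul_eq_mul, inv_mul_cancel₀ hf, mul_one, ← starRingEnd_apply,
        RCLike.conj_mul]
      norm_cast
    rw [hval, RCLike.ofReal_re]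
    positivity
  have step : ∀ n L, Good n L → ∃ L', Good (n + 1) L' ∧
      ∀ a ∈ degLT 𝕜 g (2 * (n + 1)), L' a = L a := by
    rintro n L ⟨hL, hLpos⟩
    obtain ⟨M, hM, hMdeg, hMpos⟩ := exists_functional_of_degree hI hδ h1 (Nat.le_add_left 1 n)
    obtain ⟨γ, hγ⟩ := exists_pos_functional_add_smul hI (degLT 𝕜 g (n + 1 + 1)) hL hM
      (fun a ha => (hMpos a ha).1) (fun a ha haI h0 => by
        -- Where the form of `M` degenerates, `a` has modulo `I` a representative `f` of lower
        -- degree, for which `L` is already positive.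
        obtain ⟨i, hi, f, hf, rfl⟩ := Submodule.mem_sup.1 ((hMpos a ha).2 h0)
        have hiI : i ∈ I := hi
        rw [hI.map_star_add_mul_add hL hiI]
        exact hLpos f hf fun hfI => haI (add_mem hiI hfI))
    exact ⟨L + γ • M, ⟨fun a ha => by simp [hL a ha, hM a ha], hγ⟩,
      fun a ha => by simp [hMdeg a ha]⟩
  choose next hnext hnext' using step
  obtain ⟨L0, hL0⟩ := base
  let seq : (n : ℕ) → {L // Good n L} := fun n =>
    Nat.rec ⟨L0, hL0⟩ (fun n L => ⟨next n L.1 L.2, hnext n L.1 L.2⟩) n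
  exact ⟨fun n => (seq n).1, fun n => ⟨(seq n).2.1, (seq n).2.2, hnext' n (seq n).1 (seq n).2⟩⟩

/-- A `*`-ideal respected by the derivation is the kernel of a faithful positive functional. -/
theorem exists_positive_functional {I : Ideal (FreeStarAlgebra 𝕜 g)} (hI : IsStarIdeal I)
    (hδ : ∀ f ∈ I, delta 𝕜 g f ∈ tensorKer I) (h1 : (1 : FreeStarAlgebra 𝕜 g) ∉ I) :
    ∃ L : FreeStarAlgebra 𝕜 g →ₗ[𝕜] 𝕜, (∀ a ∈ I, L a = 0) ∧
      ∀ a, a ∉ I → 0 < RCLike.re (L (star a * a)) := by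
  obtain ⟨Ls, hLs⟩ := exists_seq_functional hI hδ h1
  have hstable : ∀ n m, n ≤ m → ∀ a ∈ degLT 𝕜 g (2 * (n + 1)), Ls m a = Ls n a := by
    intro n m hnm a ha
    induction m, hnm using Nat.le_induction with
    | base => rfl
    | succ m hm ih => rw [(hLs m).2.2 a (degLT_mono (by omega) ha), ih]
  -- A word `u` has length below `2 * (u.length + 1)`, so its value no longer changes from index
  -- `u.length` on.
  let L : FreeStarAlgebra 𝕜 g →ₗ[𝕜] 𝕜 :=
    Finsupp.linearCombination 𝕜 (fun u : StarWord g => Ls u.length (monomial 𝕜 u)) ∘ₗ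
      (MonoidAlgebra.coeffLinearEquiv 𝕜).toLinearMap
  have hLu : ∀ u, L (monomial 𝕜 u) = Ls u.length (monomial 𝕜 u) := fun u => by
    simp [L, monomial]
  have hL : ∀ n, ∀ a ∈ degLT 𝕜 g (2 * (n + 1)), L a = Ls n a := fun n a ha => by
    rw [← sub_eq_zero, ← LinearMap.sub_apply, ← LinearMap.mem_ker]
    refine degLT_induction (fun u hu => ?_) ha
    rw [LinearMap.mem_ker, LinearMap.sub_apply, sub_eq_zero, hLu]
    rcases le_total n u.length with h | h
    · exact hstable n _ h _ (monomial_mem_degLT hu)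
    · exact (hstable _ n h _ (monomial_mem_degLT (by omega))).symm
  refine ⟨L, fun a ha => ?_, fun a ha => ?_⟩
  · obtain ⟨n, hn⟩ := exists_mem_degLT a
    rw [hL n a (degLT_mono (by omega) hn)]
    exact (hLs n).1 a ha
  · obtain ⟨n, hn⟩ := exists_mem_degLT a
    have hn' := degLT_mono (Nat.le_succ n) hn
    rw [hL n _ (mul_mem_degLT (star_mem_degLT hn') hn' (by omega))]
    exact (hLs n).2.1 a hn' ha

end FreeStarAlgebra

/-! ### From the functional to a representation, and realness. -/

/-- The GNS construction for a functional that is faithful modulo a `*`-ideal. -/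
theorem exists_starRep_ker_eq {𝕜 A : Type} [RCLike 𝕜] [Ring A] [StarRing A]
    [Algebra 𝕜 A] [StarModule 𝕜 A] {I : Ideal A} (hI : IsStarIdeal I) {L : A →ₗ[𝕜] 𝕜}
    (hL : ∀ a ∈ I, L a = 0) (hpos : ∀ a, a ∉ I → 0 < RCLike.re (L (star a * a))) :
    ∃ π : StarRep.{w} 𝕜 A, ∀ a, π.toAlgHom a = 0 ↔ a ∈ I := by
  -- Only the real part of `L (star a * a)` is controlled; symmetrizing makes the functional
  -- hermitian and doubles that real part.
  let F : A →ₗ[𝕜] 𝕜 :=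
    { toFun := fun a => L a + starRingEnd 𝕜 (L (star a))
      map_add' := fun a b => by simp only [star_add, map_add]; ring
      map_smul' := fun c a => by
        simp only [star_smul, map_smul, smul_eq_mul, map_mul, starRingEnd_apply, star_star,
          RingHom.id_apply]
        ring }
  have hFI : ∀ a ∈ I, F a = 0 := fun a ha => by
    change L a + starRingEnd 𝕜 (L (star a)) = 0
    rw [hL a ha, hL _ ((hI a).2 ha), map_zero, add_zero]
  have hFstar : ∀ a, starRingEnd 𝕜 (F (star a)) = F a := fun a => by
    change starRingEnd 𝕜 (L (star a) + starRingEnd 𝕜 (L (star (star a)))) =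
      L a + starRingEnd 𝕜 (L (star a))
    rw [star_star, map_add, RCLike.conj_conj, add_comm]
  have hFpos : ∀ a, a ∉ I → 0 < RCLike.re (F (star a * a)) := fun a ha => by
    change 0 < RCLike.re (L (star a * a) + starRingEnd 𝕜 (L (star (star a * a))))
    rw [star_mul, star_star, map_add, RCLike.conj_re]
    linarith [hpos a ha]
  let V : Type w := ULift.{w} (A ⧸ I.restrictScalars 𝕜)
  let mk : A →ₗ[𝕜] V := ULift.moduleEquiv.symm.toLinearMap ∘ₗ (I.restrictScalars 𝕜).mkQ
  have hmk : ∀ a, mk a = 0 ↔ a ∈ I := fun a => by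
    change ULift.moduleEquiv.symm ((I.restrictScalars 𝕜).mkQ a) = 0 ↔ a ∈ I
    rw [LinearEquiv.map_eq_zero_iff, Submodule.mkQ_apply, Submodule.Quotient.mk_eq_zero]
    rfl
  have hsurj : Function.Surjective mk :=
    ULift.moduleEquiv.symm.surjective.comp (Submodule.mkQ_surjective _)
  have hmkeq : ∀ a b, mk a = mk b ↔ a - b ∈ I := fun a b => by
    rw [← sub_eq_zero, ← map_sub, hmk]
  -- Form and action are defined through chosen representatives; `hleft` and `hright` show that `F`
  -- does not see the choice.
  choose s hs using hsurj
  have hsI : ∀ a, s (mk a) - a ∈ I := fun a => (hmkeq _ _).1 (hs _)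
  have hleft : ∀ c a, F (c * s (mk a)) = F (c * a) := fun c a => by
    rw [← sub_eq_zero, ← map_sub, ← mul_sub]
    exact hFI _ (I.mul_mem_left _ (hsI a))
  have hright : ∀ c a, F (star (s (mk a)) * c) = F (star a * c) := fun c a => by
    rw [← sub_eq_zero, ← map_sub, ← sub_mul, ← star_sub]
    exact hFI _ (hI.mul_mem_right _ ((hI _).2 (hsI a)))
  let core : InnerProductSpace.Core 𝕜 V :=
    { inner := fun v v' => F (star (s v) * s v')
      conj_inner_symm := fun v v' => by
        rw [← hFstar (star (s v) * s v'), star_mul, star_star]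
      re_inner_nonneg := fun v => by
        by_cases h : s v ∈ I
        · rw [hFI _ (I.mul_mem_left _ h), map_zero]
        · exact (hFpos _ h).le
      add_left := fun u v v' => by
        have : u + v = mk (s u + s v) := by rw [map_add, hs, hs]
        rw [this, hright, star_add, add_mul, map_add]
      smul_left := fun u v c => by
        have : c • u = mk (c • s u) := by rw [map_smul, hs]
        rw [this, hright, star_smul, smul_mul_assoc, map_smul, smul_eq_mul, starRingEnd_apply]
      definite := fun v h => by
        by_contra hv
        have : s v ∉ I := fun h' => hv (by rw [← hs v]; exact (hmk _).2 h')
        have h2 := hFpos _ this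
        rw [h, map_zero] at h2
        exact lt_irrefl _ h2 }
  let op : A →ₐ[𝕜] Module.End 𝕜 V := AlgHom.ofLinearMap
    (LinearMap.mk₂ 𝕜 (fun a v => mk (a * s v))
      (fun a b v => by rw [add_mul, map_add])
      (fun c a v => by rw [smul_mul_assoc, map_smul])
      (fun a u v => by
        rw [← map_add, hmkeq, ← mul_add, ← mul_sub]
        refine I.mul_mem_left _ ?_
        rw [← hmkeq, map_add, hs, hs, hs])
      (fun c a v => by
        rw [← map_smul, hmkeq, ← mul_smul_comm, ← mul_sub]
        refine I.mul_mem_left _ ?_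
        rw [← hmkeq, map_smul, hs, hs]))
    (by
      ext1 v
      change mk (1 * s v) = v
      rw [one_mul, hs])
    (fun a b => by
      ext1 v
      change mk (a * b * s v) = mk (a * s (mk (b * s v)))
      rw [hmkeq, mul_assoc, ← mul_sub, ← neg_sub, mul_neg]
      exact neg_mem (I.mul_mem_left _ (hsI _)))
  have hop : ∀ a v, op a v = mk (a * s v) := fun a v => rfl
  let : NormedAddCommGroup V := core.toNormedAddCommGroup
  let : InnerProductSpace 𝕜 V := InnerProductSpace.ofCore core.toCore
  refine ⟨{ V := V, toAlgHom := op, inner_map := fun a v v' => ?_ }, fun a => ⟨fun h => ?_, ?_⟩⟩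
  · change F (star (s (mk (a * s v))) * s v') = F (star (s v) * s (mk (star a * s v')))
    rw [hright, hleft, star_mul, mul_assoc]
  -- The class of `1` is a separating vector: `a` sends it to the class of `a`.
  · have h0 : op a (mk 1) = 0 := by
      have : op a = 0 := h
      rw [this, LinearMap.zero_apply]
    rw [hop, hmk] at h0
    have := I.sub_mem h0 (I.mul_mem_left a (hsI 1))
    simpa [mul_sub] using this
  · intro ha
    change op a = 0
    ext1 v
    rw [hop, LinearMap.zero_apply, hmk]
    exact hI.mul_mem_right _ ha

/-- For a `*`-ideal, `I + I^* = I`, so a representation killing `I` kills the sum of squares;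
pairing with `v` gives `∑ ‖π(a_j) v‖² = 0`. -/
theorem isRealIdeal_of_hardRadical_le {𝕜 A : Type*} [RCLike 𝕜] [Ring A] [StarRing A]
    [Algebra 𝕜 A] {I : Ideal A} (hI : IsStarIdeal I)
    (h : hardRadical (Set.univ : Set (StarRep.{w} 𝕜 A)) (I : Set A) ≤ I) : IsRealIdeal I := by
  rintro n a ⟨b, hb, c, hc, hsum⟩ j
  refine h fun π hπ => ?_
  have hmem : ∑ j, star (a j) * a j ∈ I := by
    rw [hsum]
    exact add_mem hb ((hI c).2 hc)
  have h0 := hπ.2 _ hmem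
  ext v
  have h1 : ∑ j, ‖π.toAlgHom (a j) v‖ ^ 2 = 0 := by
    have h2 : inner 𝕜 v (π.toAlgHom (∑ j, star (a j) * a j) v) = 0 := by rw [h0]; simp
    rw [map_sum, LinearMap.sum_apply, inner_sum] at h2
    have h3 := congrArg RCLike.re h2
    rw [map_sum, map_zero] at h3
    rw [← h3]
    refine Finset.sum_congr rfl fun i _ => ?_
    rw [map_mul, Module.End.mul_apply, ← π.inner_map, inner_self_eq_norm_sq]
  rw [Finset.sum_eq_zero_iff_of_nonneg (fun _ _ => by positivity)] at h1
  simpa using h1 j (Finset.mem_univ j)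

theorem corollary4p4 {𝕜 : Type} [RCLike 𝕜] (g : ℕ)
    (S : Set (FreeStarAlgebra 𝕜 g)) (hS : ∀ p ∈ S, p ∈ FreeStarAlgebra.analytic 𝕜 g)
    (I : Ideal (FreeStarAlgebra 𝕜 g)) (hI : I = starIdealSpan S) :
    realRadical I = I ∧
      hardRadical (Set.univ : Set (StarRep.{w} 𝕜 (FreeStarAlgebra 𝕜 g)))
        (I : Set (FreeStarAlgebra 𝕜 g)) = I ∧
      IsRealIdeal I := by
  have hstar : IsStarIdeal I := hI ▸ isStarIdeal_starIdealSpan S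
  have hle : hardRadical (Set.univ : Set (StarRep.{w} 𝕜 (FreeStarAlgebra 𝕜 g)))
      (I : Set (FreeStarAlgebra 𝕜 g)) ≤ I := by
    by_cases h1 : (1 : FreeStarAlgebra 𝕜 g) ∈ I
    -- No functional normalized at `1` can vanish on `I` here, but then `I` is the whole algebra.
    · rw [(Ideal.eq_top_iff_one I).2 h1]
      exact le_top
    · obtain ⟨L, hL, hpos⟩ := FreeStarAlgebra.exists_positive_functional hstar
        (fun f hf => by subst hI; exact FreeStarAlgebra.delta_mem_tensorKer hS hf) h1
      obtain ⟨π, hπ⟩ := exists_starRep_ker_eq.{w} hstar hL hpos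
      exact fun a ha => (hπ a).1 (ha π ⟨trivial, fun s hs => (hπ s).2 hs⟩)
  have hreal : IsRealIdeal I := isRealIdeal_of_hardRadical_le hstar hle
  exact ⟨le_antisymm (sInf_le ⟨hreal, le_rfl⟩) (le_sInf fun J hJ => hJ.2),
    le_antisymm hle fun a ha π hπ => hπ.2 a ha, hreal⟩
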